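/- All Hilbert spaces are finite-dimensional, all index sets are finite, and a \emph{faithful} state or distribution is a strictly positive density matrix, respectively a probability distribution of full support; a probability distribution $p$ is identified with the diagonal density matrix $\mathrm{diag}(p)$. Let $D^Q(\rho\|\sigma)\in[-\infty,\infty]$ be a quantity defined for all pairs of faithful states on a common space, in every finite dimension, which agrees with the classical relative entropy on faithful probability distributions: $D^Q(p\|q)=\sum_x p(x)\log\frac{p(x)}{q(x)}$. For faithful states $\rho,\sigma$ on the same space put $$D(\rho\|\sigma)=\operatorname{Tr}\rho(\log\rho-\log\sigma),\qquad D^R(\rho\|\sigma)=\int_0^1\!\int_0^t J^R_s\,ds\,dt,$$ where $J^R_s=\operatorname{Tr}\rho_s L_s^\dagger L_s$ is the right-logarithmic-derivative (RLD) Fisher information of the family $\rho_s=s\rho+(1-s)\sigma$, i.e. $L_s$ is the solution of $\rho-\sigma=L_s\rho_s$. (i) Suppose that $D^Q$ is additive, $D^Q(\rho_1\otimes\rho_2\|\sigma_1\otimes\sigma_2)=D^Q(\rho_1\|\sigma_1)+D^Q(\rho_2\|\sigma_2)$ for faithful states, and non-increasing under QC maps, i.e. $D^Q(p\|q)\le D^Q(\rho\|\sigma)$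 whenever $p(x)=\operatorname{Tr}\rho M_x$ and $q(x)=\operatorname{Tr}\sigma M_x$ for a POVM $(M_x)$ and $\rho,\sigma,p,q$ are faithful. Then $D(\rho\|\sigma)\le D^Q(\rho\|\sigma)$ for all faithful states $\rho,\sigma$ on the same space. (ii) Suppose that $D^Q$ is non-increasing under CQ maps, i.e. for all density matrices $\omega_x$ (possibly singular) $D^Q\big(\sum_x p(x)\omega_x\big\|\sum_x q(x)\omega_x\big)\le D^Q(p\|q)$ whenever $p,q$ and both output states are faithful. Then $D^Q(\rho\|\sigma)\le D^R(\rho\|\sigma)$ for all faithful states $\rho,\sigma$ on the same space. (iii) Moreover, $D^R(\rho\|\sigma)=\operatorname{Tr}\rho\log\big(\rho^{1/2}\sigma^{-1}\rho^{1/2}\big)$ for all faithful states $\rho,\sigma$ on the same space. -/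

import Mathlib

open Matrix
open scoped Kronecker ComplexOrder

namespace QDiv

noncomputable section

/-- A strictly positive density matrix on the Hilbert space with orthonormal basis indexed by `ι`. -/
def IsFaithfulState {ι : Type} [Fintype ι] (ρ : Matrix ι ι ℂ) : Prop :=
  ρ.PosDef ∧ ρ.trace = 1

/-- A probability distribution of full support on the finite set `X`. -/
def IsFaithfulDist {X : Type} [Fintype X] (p : X → ℝ) : Prop :=
  (∀ x, 0 < p x) ∧ ∑ x, p x = 1

/-- The density matrix, diagonal in the standard basis, that represents a distribution. -/
def classicalState {X : Type} [DecidableEq X] (p : X → ℝ) : Matrix X X ℂ :=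
  diagonal fun x => (p x : ℂ)

/-- Classical relative entropy `D(p‖q) = ∑ x, p x log (p x / q x)`. -/
def classicalDiv {X : Type} [Fintype X] (p q : X → ℝ) : ℝ :=
  ∑ x, p x * Real.log (p x / q x)

/-- Umegaki relative entropy `Tr ρ (log ρ - log σ)`. -/
def umegaki {ι : Type} [Fintype ι] [DecidableEq ι] (ρ σ : Matrix ι ι ℂ) : ℝ :=
  (ρ * (cfc Real.log ρ - cfc Real.log σ)).trace.re

/-- The right logarithmic derivative of the tangent vector `X` at `ρ`: the solution `L` of
`X = L ρ`, see `mul_eq_iff_eq_rld`. -/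
def rld {ι : Type} [Fintype ι] [DecidableEq ι] (ρ X : Matrix ι ι ℂ) : Matrix ι ι ℂ :=
  X * ρ⁻¹

/-- At a strictly positive `ρ`, `rld ρ X` is the unique solution of the defining equation. -/
theorem mul_eq_iff_eq_rld {ι : Type} [Fintype ι] [DecidableEq ι] {ρ : Matrix ι ι ℂ}
    (hρ : ρ.PosDef) (X L : Matrix ι ι ℂ) : L * ρ = X ↔ L = rld ρ X := by
  have hu : IsUnit ρ.det := (Matrix.isUnit_iff_isUnit_det ρ).1 hρ.isUnit
  constructor
  · rintro rfl
    exact (Matrix.mul_nonsing_inv_cancel_right ρ L hu).symm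
  · rintro rfl
    exact Matrix.nonsing_inv_mul_cancel_right ρ X hu

/-- The RLD Fisher information `Tr ρ L† L` of the tangent vector `X` at `ρ`. -/
def rldFisher {ι : Type} [Fintype ι] [DecidableEq ι] (ρ X : Matrix ι ι ℂ) : ℝ :=
  (ρ * (rld ρ X)ᴴ * rld ρ X).trace.re

/-- The RLD divergence `D^R(ρ‖σ) = ∫₀¹ ∫₀ᵗ J_s ds dt`, with `J_s` the RLD Fisher information of the
family `s ↦ s ρ + (1 - s) σ`, whose tangent vector is `ρ - σ`. -/
def rldDiv {ι : Type} [Fintype ι] [DecidableEq ι] (ρ σ : Matrix ι ι ℂ) : ℝ :=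
  ∫ t in (0 : ℝ)..1, ∫ s in (0 : ℝ)..t, rldFisher ((s : ℂ) • ρ + ((1 - s : ℝ) : ℂ) • σ) (ρ - σ)

/-- A QC map (a measurement) with outcomes in `X`, given by its POVM. -/
structure QCMap (ι X : Type) [Fintype ι] [DecidableEq ι] [Fintype X] where
  /-- the POVM element of each outcome -/
  effect : X → Matrix ι ι ℂ
  posSemidef : ∀ x, (effect x).PosSemidef
  sum_eq_one : ∑ x, effect x = 1

/-- The output distribution `x ↦ Tr ρ M_x`. -/
def QCMap.apply {ι X : Type} [Fintype ι] [DecidableEq ι] [Fintype X] (M : QCMap ι X)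
    (ρ : Matrix ι ι ℂ) : X → ℝ :=
  fun x => (ρ * M.effect x).trace.re

/-- A CQ map: a density matrix, possibly singular, is prepared for each classical input. -/
structure CQMap (X ι : Type) [Fintype ι] where
  /-- the state prepared on each input -/
  state : X → Matrix ι ι ℂ
  posSemidef : ∀ x, (state x).PosSemidef
  trace_eq_one : ∀ x, (state x).trace = 1

/-- The output state `∑ x, p x ρ_x`. -/
def CQMap.apply {X ι : Type} [Fintype X] [Fintype ι] (Φ : CQMap X ι) (p : X → ℝ) :
    Matrix ι ι ℂ :=
  ∑ x, (p x : ℂ) • Φ.state x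

/-- A quantity assigning an extended real to each pair of matrices in each finite dimension. All
conditions below concern strictly positive density matrices only; other values are irrelevant. -/
abbrev Quantity : Type 1 :=
  ∀ (ι : Type) [Fintype ι], Matrix ι ι ℂ → Matrix ι ι ℂ → EReal

/-- `D` coincides with the classical relative entropy on probability distributions. -/
def AgreesWithClassical (D : Quantity) : Prop :=
  ∀ (X : Type) [Fintype X] [DecidableEq X] (p q : X → ℝ),
    IsFaithfulDist p → IsFaithfulDist q →
      D X (classicalState p) (classicalState q) = ((classicalDiv p q : ℝ) : EReal)

/-- `D` is additive on tensor products. -/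
def IsAdditive (D : Quantity) : Prop :=
  ∀ (ι κ : Type) [Fintype ι] [Fintype κ] (ρ₁ σ₁ : Matrix ι ι ℂ) (ρ₂ σ₂ : Matrix κ κ ℂ),
    IsFaithfulState ρ₁ → IsFaithfulState σ₁ → IsFaithfulState ρ₂ → IsFaithfulState σ₂ →
      D (ι × κ) (ρ₁ ⊗ₖ ρ₂) (σ₁ ⊗ₖ σ₂) = D ι ρ₁ σ₁ + D κ ρ₂ σ₂

/-- `D` is non-increasing under QC maps. -/
def QCMonotone (D : Quantity) : Prop :=
  ∀ (ι X : Type) [Fintype ι] [DecidableEq ι] [Fintype X] [DecidableEq X] (M : QCMap ι X)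
    (ρ σ : Matrix ι ι ℂ), IsFaithfulState ρ → IsFaithfulState σ →
      IsFaithfulDist (M.apply ρ) → IsFaithfulDist (M.apply σ) →
        D X (classicalState (M.apply ρ)) (classicalState (M.apply σ)) ≤ D ι ρ σ

/-- `D` is non-increasing under CQ maps. -/
def CQMonotone (D : Quantity) : Prop :=
  ∀ (X ι : Type) [Fintype X] [DecidableEq X] [Fintype ι] (Φ : CQMap X ι)
    (p q : X → ℝ), IsFaithfulDist p → IsFaithfulDist q →
      IsFaithfulState (Φ.apply p) → IsFaithfulState (Φ.apply q) →
        D ι (Φ.apply p) (Φ.apply q) ≤ D X (classicalState p) (classicalState q)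

end

end QDiv

/-!
**The upper bound.** Put `S = ρ^{1/2} σ⁻¹ ρ^{1/2}`, diagonalize `S = V diag(s) Vᴴ` and set
`A = ρ^{1/2} V`. Then `ρ = A Aᴴ` and `σ = A diag(s⁻¹) Aᴴ` (`exists_simultaneous_congruence`), so the
pair behaves like a commuting one. With `w k = (Aᴴ A) k k`, both `Tr ρ log S` and the double
integral of the RLD Fisher information equal `∑ k, w k log (s k)`: along the segment `ρ_x` the
information is `∑ k, w k (1 - u k)² / (x + (1 - x) u k)` with `u = s⁻¹`, and its double integral is
elementary (`rldDiv_eq_sum_log`, `rldDiv_eq_trace_log`). The normalized columns of `A` give the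
states of a CQ map that sends the distributions `w` and `w / s` to `ρ` and `σ`; their classical
divergence is again `∑ k, w k log (s k)`, and monotonicity gives the bound
(`CQMonotone.le_rldDiv`).

**The lower bound.** If `σ` is constant on the cells of a partition of its eigenbasis into `|C|`
cells, choose inside each cell a basis that diagonalizes the corresponding block of `ρ`. The
pinching inequality `ρ ≤ |C| E(ρ)`, where `E(ρ)` is diagonal in the new basis, and operator
monotonicity of the logarithm show that measuring in this basis loses at most `log |C|` of the
Umegaki relative entropy (`exists_measurement_umegaki_le`). For `σ^{⊗n}` the cells are the types, at
most `(n + 1) ^ |ι|` of them (`IsAdditive.exists_tensor_power`), so additivity gives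
`n D(ρ‖σ) ≤ n D^Q(ρ‖σ) + |ι| log (n + 1)`; dividing by `n` and letting `n → ∞` gives the bound
(`IsAdditive.umegaki_le`).
-/

namespace QDiv

/-! ### Functional calculus of a diagonalized matrix -/

section Spectral

variable {ι κ : Type} [Fintype ι] [DecidableEq ι] [Fintype κ] [DecidableEq κ]

omit [DecidableEq ι] in
theorem trace_mul_conj_diagonal (N : Matrix ι ι ℂ) (U : Matrix ι κ ℂ) (d : κ → ℂ) :
    (N * (U * diagonal d * Uᴴ)).trace = ∑ k, (Uᴴ * N * U) k k * d k := by
  have h : (N * (U * diagonal d * Uᴴ)).trace = (Uᴴ * N * U * diagonal d).trace := by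
    rw [trace_mul_comm, Matrix.mul_assoc, trace_mul_comm, ← Matrix.mul_assoc]
  rw [h]
  simp [Matrix.trace, Matrix.mul_diagonal]

theorem trace_conj_diagonal (A : Matrix ι κ ℂ) (d : κ → ℂ) :
    (A * diagonal d * Aᴴ).trace = ∑ k, (Aᴴ * A) k k * d k := by
  simpa using trace_mul_conj_diagonal 1 A d

omit [DecidableEq ι] in
theorem conj_diagonal_mul {U : Matrix ι κ ℂ} (hU : Uᴴ * U = 1) (a b : κ → ℂ) :
    U * diagonal a * Uᴴ * (U * diagonal b * Uᴴ) = U * diagonal (fun k => a k * b k) * Uᴴ := by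
  calc U * diagonal a * Uᴴ * (U * diagonal b * Uᴴ)
      = U * diagonal a * (Uᴴ * U) * (diagonal b * Uᴴ) := by simp only [Matrix.mul_assoc]
    _ = _ := by rw [hU, Matrix.mul_one, ← diagonal_mul_diagonal]; simp only [Matrix.mul_assoc]

theorem aeval_conj_diagonal {U : Matrix ι κ ℂ} (hU : Uᴴ * U = 1) (hU' : U * Uᴴ = 1)
    (a : κ → ℝ) (q : Polynomial ℝ) :
    Polynomial.aeval (U * diagonal (fun k => (a k : ℂ)) * Uᴴ) q =
      U * diagonal (fun k => ((q.eval (a k) : ℝ) : ℂ)) * Uᴴ := by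
  have hpow (n : ℕ) : (U * diagonal (fun k => (a k : ℂ)) * Uᴴ) ^ n =
      U * diagonal (fun k => (a k : ℂ) ^ n) * Uᴴ := by
    induction n with
    | zero => simp [hU']
    | succ n ih => rw [pow_succ, ih, conj_diagonal_mul hU]; simp only [pow_succ]
  induction q using Polynomial.induction_on' with
  | add p q hp hq =>
    rw [map_add, hp, hq, ← Matrix.add_mul, ← Matrix.mul_add, diagonal_add]
    simp
  | monomial n r =>
    rw [Polynomial.aeval_monomial, hpow, ← Algebra.smul_def, ← Matrix.smul_mul, ← Matrix.mul_smul,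
      ← diagonal_smul]
    congr 3
    ext k
    simp

/-- The functional calculus acts on the eigenvalues of any diagonalization, also one by a unitary
between different index types. -/
theorem cfc_conj_diagonal {U : Matrix ι κ ℂ} (hU : Uᴴ * U = 1) (hU' : U * Uᴴ = 1)
    (a : κ → ℝ) (f : ℝ → ℝ) :
    cfc f (U * diagonal (fun k => (a k : ℂ)) * Uᴴ) =
      U * diagonal (fun k => ((f (a k) : ℝ) : ℂ)) * Uᴴ := by
  set M := U * diagonal (fun k => (a k : ℂ)) * Uᴴ with hM
  have hH : M.IsHermitian := by
    simp [hM, Matrix.IsHermitian, conjTranspose_mul, diagonal_conjTranspose, Matrix.mul_assoc,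
      Pi.star_def]
  -- A polynomial that agrees with `f` at all `a k` and on the spectrum of `M`
  let S : Finset ℝ := Finset.univ.image a ∪ Finset.univ.image hH.eigenvalues
  let q := Lagrange.interpolate S id f
  have hq (x : ℝ) (hx : x ∈ S) : q.eval x = f x :=
    Lagrange.eval_interpolate_at_node f (Function.injective_id.injOn) hx
  have h1 : cfc f M = cfc q.eval M := by
    refine cfc_congr fun x hx => ?_
    rw [hH.spectrum_real_eq_range_eigenvalues] at hx
    obtain ⟨i, rfl⟩ := hx
    exact (hq _ (by simp [S])).symm
  have h2 : cfc q.eval M = Polynomial.aeval M q := cfc_polynomial q M hH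
  rw [h1, h2, hM, aeval_conj_diagonal hU hU']
  congr 3
  ext k
  rw [hq _ (by simp [S])]

theorem eq_conj_diagonal_eigenvalues {A : Matrix ι ι ℂ} (hA : A.IsHermitian) :
    A = hA.eigenvectorUnitary * diagonal (fun i => (hA.eigenvalues i : ℂ)) *
      (hA.eigenvectorUnitary : Matrix ι ι ℂ)ᴴ := by
  conv_lhs => rw [hA.spectral_theorem]
  rw [Unitary.conjStarAlgAut_apply]
  rfl

theorem exists_unitary_diagonalization {A : Matrix ι ι ℂ} (hA : A.IsHermitian) :
    ∃ (U : Matrix ι ι ℂ) (a : ι → ℝ), Uᴴ * U = 1 ∧ U * Uᴴ = 1 ∧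
      A = U * diagonal (fun i => (a i : ℂ)) * Uᴴ :=
  ⟨hA.eigenvectorUnitary, hA.eigenvalues, Unitary.coe_star_mul_self _,
    Unitary.coe_mul_star_self _, eq_conj_diagonal_eigenvalues hA⟩

theorem exists_unitary_diagonalization_pos {A : Matrix ι ι ℂ} (hA : A.PosDef) :
    ∃ (U : Matrix ι ι ℂ) (a : ι → ℝ), Uᴴ * U = 1 ∧ U * Uᴴ = 1 ∧ (∀ i, 0 < a i) ∧
      A = U * diagonal (fun i => (a i : ℂ)) * Uᴴ :=
  ⟨hA.isHermitian.eigenvectorUnitary, hA.isHermitian.eigenvalues, Unitary.coe_star_mul_self _,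
    Unitary.coe_mul_star_self _, hA.eigenvalues_pos, eq_conj_diagonal_eigenvalues hA.isHermitian⟩

end Spectral

/-! ### Simultaneous diagonalization of two states by congruence -/

section Reverse

variable {ι : Type} [Fintype ι] [DecidableEq ι]

/-- The columns of `A = ρ^{1/2} V`, with `V` diagonalizing `ρ^{1/2} σ⁻¹ ρ^{1/2}` with eigenvalues
`s`, diagonalize `ρ` and `σ` simultaneously by congruence; `w` is the diagonal of `Aᴴ A`. -/
theorem exists_simultaneous_congruence {ρ σ : Matrix ι ι ℂ} (hρ : ρ.PosDef) (hσ : σ.PosDef) :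
    ∃ (A : Matrix ι ι ℂ) (s w : ι → ℝ), (∀ k, 0 < s k) ∧ (∀ k, 0 < w k) ∧
      (∀ k, (Aᴴ * A) k k = (w k : ℂ)) ∧ ρ = A * Aᴴ ∧
      σ = A * diagonal (fun k => ((s k)⁻¹ : ℂ)) * Aᴴ ∧
      (ρ * cfc Real.log (cfc Real.sqrt ρ * σ⁻¹ * cfc Real.sqrt ρ)).trace =
        ∑ k, (w k : ℂ) * (Real.log (s k) : ℂ) := by
  obtain ⟨U, a, hU, hU', ha, hρU⟩ := exists_unitary_diagonalization_pos hρ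
  set R := cfc Real.sqrt ρ with hR
  have hRU : R = U * diagonal (fun i => ((Real.sqrt (a i) : ℝ) : ℂ)) * Uᴴ := by
    rw [hR, hρU, cfc_conj_diagonal hU hU']
  have hRR : R * R = ρ := by
    rw [hRU, conj_diagonal_mul hU, hρU]
    congr 3
    ext i
    rw [← Complex.ofReal_mul, Real.mul_self_sqrt (ha i).le]
  have hRH : Rᴴ = R := by
    rw [hRU]
    simp [conjTranspose_mul, diagonal_conjTranspose, Matrix.mul_assoc, Pi.star_def]
  have hRu : IsUnit R.det := by
    have h := (Matrix.isUnit_iff_isUnit_det ρ).1 hρ.isUnit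
    rw [← hRR, det_mul] at h
    exact isUnit_of_mul_isUnit_left h
  have hinj : Function.Injective R.mulVec :=
    Matrix.mulVec_injective_of_isUnit ((Matrix.isUnit_iff_isUnit_det R).2 hRu)
  have hS : (R * σ⁻¹ * R).PosDef := by
    have := hσ.inv.conjTranspose_mul_mul_same (B := R) hinj
    rwa [hRH] at this
  obtain ⟨V, s, hV, hV', hs, hSV⟩ := exists_unitary_diagonalization_pos hS
  have hAA : (R * V)ᴴ * (R * V) = Vᴴ * ρ * V := by
    rw [conjTranspose_mul, hRH, ← hRR]; simp only [Matrix.mul_assoc]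
  have hpos : (Vᴴ * ρ * V).PosDef := by
    refine hρ.conjTranspose_mul_mul_same (B := V) ?_
    exact Matrix.mulVec_injective_of_isUnit ⟨⟨V, Vᴴ, hV', hV⟩, rfl⟩
  have hw (k : ι) : (Vᴴ * ρ * V) k k = (((Vᴴ * ρ * V) k k).re : ℂ) := by
    have := (hpos.diag_pos (i := k)).le
    exact Complex.eq_re_of_ofReal_le (r := 0) (by simpa using this)
  refine ⟨R * V, s, fun k => ((Vᴴ * ρ * V) k k).re, hs, fun k => ?_, fun k => ?_, ?_, ?_, ?_⟩
  · exact (Complex.pos_iff.1 (hpos.diag_pos (i := k))).1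
  · rw [hAA]; exact hw k
  · calc ρ = R * (V * Vᴴ) * R := by rw [hV', Matrix.mul_one, hRR]
      _ = _ := by rw [conjTranspose_mul, hRH]; simp only [Matrix.mul_assoc]
  · have hSinv : V * diagonal (fun k => ((s k)⁻¹ : ℂ)) * Vᴴ = (R * σ⁻¹ * R)⁻¹ := by
      refine (Matrix.inv_eq_left_inv ?_).symm
      rw [hSV, conj_diagonal_mul hV]
      have : (fun k => ((s k : ℂ))⁻¹ * (s k : ℂ)) = fun _ => 1 := by
        ext k
        exact inv_mul_cancel₀ (by exact_mod_cast (hs k).ne')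
      rw [this, diagonal_one, Matrix.mul_one, hV']
    have : R * V * diagonal (fun k => ((s k)⁻¹ : ℂ)) * (R * V)ᴴ =
        R * (V * diagonal (fun k => ((s k)⁻¹ : ℂ)) * Vᴴ) * R := by
      rw [conjTranspose_mul, hRH]; simp only [Matrix.mul_assoc]
    rw [this, hSinv, Matrix.mul_inv_rev, Matrix.mul_inv_rev,
      nonsing_inv_nonsing_inv _ ((Matrix.isUnit_iff_isUnit_det σ).1 hσ.isUnit)]
    rw [← Matrix.mul_assoc, Matrix.mul_nonsing_inv _ hRu, Matrix.one_mul, Matrix.mul_assoc,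
      Matrix.nonsing_inv_mul _ hRu, Matrix.mul_one]
  · rw [hSV, cfc_conj_diagonal hV hV', trace_mul_conj_diagonal]
    exact Finset.sum_congr rfl fun k _ => by rw [← hw k]

end Reverse

/-! ### Two elementary integrals -/

section Integral

/-- The inner integral of the Fisher information, with `u` the ratio `σ / ρ` of one eigenvalue. -/
theorem integral_sq_div_affine {u t : ℝ} (hu : 0 < u) (ht : t ∈ Set.Icc (0 : ℝ) 1) :
    IntervalIntegrable (fun s => (1 - u) ^ 2 / (s + (1 - s) * u)) MeasureTheory.volume 0 t ∧
    ∫ s in (0 : ℝ)..t, (1 - u) ^ 2 / (s + (1 - s) * u) =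
      (1 - u) * (Real.log (t + (1 - t) * u) - Real.log u) := by
  have hv : ∀ s ∈ Set.uIcc (0 : ℝ) t, 0 < s + (1 - s) * u := by
    intro s hs
    rw [Set.uIcc_of_le ht.1] at hs
    rcases hs.1.eq_or_lt with h | h
    · rw [← h]; simpa
    · have : 0 ≤ (1 - s) * u := mul_nonneg (by linarith [hs.2, ht.2]) hu.le
      linarith
  have hint : IntervalIntegrable (fun s => (1 - u) ^ 2 / (s + (1 - s) * u))
      MeasureTheory.volume 0 t := by
    refine ContinuousOn.intervalIntegrable (ContinuousOn.div (by fun_prop) (by fun_prop) ?_)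
    exact fun s hs => (hv s hs).ne'
  refine ⟨hint, ?_⟩
  rw [intervalIntegral.integral_eq_sub_of_hasDerivAt
    (f := fun s => (1 - u) * Real.log (s + (1 - s) * u)) _ hint]
  · simp only [zero_add, sub_zero, one_mul]; ring
  · intro s hs
    have h1 : HasDerivAt (fun s : ℝ => s + (1 - s) * u) (1 + (-1) * u) s :=
      (hasDerivAt_id s).add (((hasDerivAt_id s).const_sub 1).mul_const u)
    exact ((h1.log (hv s hs).ne').const_mul (1 - u)).congr_deriv (by ring)

theorem integral_log_affine {u : ℝ} (hu : 0 < u) :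
    IntervalIntegrable (fun t => (1 - u) * (Real.log (t + (1 - t) * u) - Real.log u))
      MeasureTheory.volume 0 1 ∧
    ∫ t in (0 : ℝ)..1, (1 - u) * (Real.log (t + (1 - t) * u) - Real.log u) =
      u - 1 - Real.log u := by
  have hv : ∀ s ∈ Set.uIcc (0 : ℝ) 1, 0 < s + (1 - s) * u := by
    intro s hs
    rw [Set.uIcc_of_le zero_le_one] at hs
    rcases hs.1.eq_or_lt with h | h
    · rw [← h]; simpa
    · have : 0 ≤ (1 - s) * u := mul_nonneg (by linarith [hs.2]) hu.le
      linarith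
  have hint : IntervalIntegrable (fun t => (1 - u) * (Real.log (t + (1 - t) * u) - Real.log u))
      MeasureTheory.volume 0 1 := by
    refine ContinuousOn.intervalIntegrable (ContinuousOn.mul (by fun_prop)
      (ContinuousOn.sub (ContinuousOn.log (by fun_prop) ?_) (by fun_prop)))
    exact fun s hs => (hv s hs).ne'
  refine ⟨hint, ?_⟩
  rw [intervalIntegral.integral_eq_sub_of_hasDerivAt
    (f := fun t => (t + (1 - t) * u) * Real.log (t + (1 - t) * u) - (t + (1 - t) * u)
      - t * ((1 - u) * Real.log u)) _ hint]
  · simp; ring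
  · intro s hs
    have h1 : HasDerivAt (fun s : ℝ => s + (1 - s) * u) (1 + (-1) * u) s :=
      (hasDerivAt_id s).add (((hasDerivAt_id s).const_sub 1).mul_const u)
    refine (((h1.mul (h1.log (hv s hs).ne')).sub h1).sub
      ((hasDerivAt_id' s).mul_const ((1 - u) * Real.log u))).congr_deriv ?_
    rw [mul_div_cancel₀ _ (hv s hs).ne']
    ring

end Integral

/-! ### The RLD divergence and the upper bound -/

section RLD

variable {ι : Type} [Fintype ι] [DecidableEq ι]

/-- Congruence by an invertible `A` turns the RLD Fisher information into the classical one, with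
the diagonal of `Aᴴ A` as weights: the logarithmic derivative is `A diag(y / v) A⁻¹`. -/
theorem rldFisher_conj_diagonal {A : Matrix ι ι ℂ} {v y w : ι → ℝ}
    (hA : IsUnit A.det) (hw : ∀ k, (Aᴴ * A) k k = (w k : ℂ)) (hv : ∀ k, 0 < v k) :
    rldFisher (A * diagonal (fun k => (v k : ℂ)) * Aᴴ) (A * diagonal (fun k => (y k : ℂ)) * Aᴴ) =
      ∑ k, w k * (y k ^ 2 / v k) := by
  have hH (d : ι → ℝ) : (A * diagonal (fun k => (d k : ℂ)) * Aᴴ)ᴴ =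
      A * diagonal (fun k => (d k : ℂ)) * Aᴴ := by
    simp [conjTranspose_mul, diagonal_conjTranspose, Matrix.mul_assoc, Pi.star_def]
  have hpd : (A * diagonal (fun k => (v k : ℂ)) * Aᴴ).PosDef := by
    refine PosDef.mul_mul_conjTranspose_same ?_ ?_
    · exact Matrix.PosDef.diagonal fun k => by exact_mod_cast hv k
    · exact Matrix.vecMul_injective_of_isUnit ((Matrix.isUnit_iff_isUnit_det A).2 hA)
  -- `L = A diag(y / v) A⁻¹` is the logarithmic derivative.
  have hL : (A * diagonal (fun k => ((y k / v k : ℝ) : ℂ)) * A⁻¹) *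
      (A * diagonal (fun k => (v k : ℂ)) * Aᴴ) = A * diagonal (fun k => (y k : ℂ)) * Aᴴ := by
    calc _ = A * diagonal (fun k => ((y k / v k : ℝ) : ℂ)) * (A⁻¹ * A) *
        (diagonal (fun k => (v k : ℂ)) * Aᴴ) := by simp only [Matrix.mul_assoc]
      _ = A * (diagonal (fun k => ((y k / v k : ℝ) : ℂ)) * diagonal (fun k => (v k : ℂ))) * Aᴴ := by
        rw [nonsing_inv_mul _ hA, Matrix.mul_one]; simp only [Matrix.mul_assoc]
      _ = _ := by
        rw [diagonal_mul_diagonal]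
        congr 3
        ext k
        rw [← Complex.ofReal_mul, div_mul_cancel₀ _ (hv k).ne']
  rw [rldFisher, ← (mul_eq_iff_eq_rld hpd _ _).1 hL]
  -- `ρ Lᴴ = (L ρ)ᴴ` is the tangent vector itself, which is Hermitian.
  nth_rewrite 1 [← hH v]
  rw [← conjTranspose_mul, hL, hH y]
  have htr : (A * diagonal (fun k => (y k : ℂ)) * Aᴴ *
      (A * diagonal (fun k => ((y k / v k : ℝ) : ℂ)) * A⁻¹)).trace =
      ∑ k, ((w k * (y k ^ 2 / v k) : ℝ) : ℂ) := by
    have h2 : A * diagonal (fun k => (y k : ℂ)) * Aᴴ *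
        (A * diagonal (fun k => ((y k / v k : ℝ) : ℂ)) * A⁻¹) =
        A * (diagonal (fun k => (y k : ℂ)) * (Aᴴ * A) *
          diagonal (fun k => ((y k / v k : ℝ) : ℂ))) * A⁻¹ := by simp only [Matrix.mul_assoc]
    rw [h2, trace_mul_comm, ← Matrix.mul_assoc, nonsing_inv_mul _ hA, Matrix.one_mul]
    simp only [Matrix.trace, diag_apply, Matrix.mul_diagonal, Matrix.diagonal_mul, hw]
    refine Finset.sum_congr rfl fun k _ => ?_
    push_cast
    ring
  rw [htr, ← Complex.ofReal_sum, Complex.ofReal_re]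

/-- Each eigenvalue ratio `u = (s k)⁻¹` contributes `w k (u - 1 - log u)`; the affine terms cancel
since `∑ k, w k = Tr ρ = 1` and `∑ k, w k u k = Tr σ = 1`. -/
theorem rldDiv_eq_sum_log {ρ σ A : Matrix ι ι ℂ} {s w : ι → ℝ} (hρ : IsFaithfulState ρ)
    (hσ : IsFaithfulState σ) (hs : ∀ k, 0 < s k)
    (hw : ∀ k, (Aᴴ * A) k k = (w k : ℂ)) (hρA : ρ = A * Aᴴ)
    (hσA : σ = A * diagonal (fun k => ((s k)⁻¹ : ℂ)) * Aᴴ) :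
    rldDiv ρ σ = ∑ k, w k * Real.log (s k) := by
  have hA : IsUnit A.det := by
    have h := (Matrix.isUnit_iff_isUnit_det ρ).1 hρ.1.isUnit
    rw [hρA, det_mul] at h
    exact isUnit_of_mul_isUnit_left h
  have hsumw : ∑ k, w k = 1 := by
    have h := hρ.2
    rw [hρA, trace_mul_comm] at h
    simp only [Matrix.trace, diag_apply, hw] at h
    exact_mod_cast h
  have hsumq : ∑ k, w k * (s k)⁻¹ = 1 := by
    have h := hσ.2
    rw [hσA, trace_conj_diagonal] at h
    simp only [hw] at h
    exact_mod_cast h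
  have hu (k : ι) : 0 < (s k)⁻¹ := inv_pos.2 (hs k)
  have hJ (x : ℝ) (hx : x ∈ Set.Icc (0 : ℝ) 1) :
      rldFisher ((x : ℂ) • ρ + ((1 - x : ℝ) : ℂ) • σ) (ρ - σ) =
        ∑ k, w k * ((1 - (s k)⁻¹) ^ 2 / (x + (1 - x) * (s k)⁻¹)) := by
    have h1 : (x : ℂ) • ρ + ((1 - x : ℝ) : ℂ) • σ =
        A * diagonal (fun k => ((x + (1 - x) * (s k)⁻¹ : ℝ) : ℂ)) * Aᴴ := by
      have : diagonal (fun k => ((x + (1 - x) * (s k)⁻¹ : ℝ) : ℂ)) =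
          (x : ℂ) • (1 : Matrix ι ι ℂ) +
            ((1 - x : ℝ) : ℂ) • diagonal (fun k => ((s k)⁻¹ : ℂ)) := by
        ext i j
        by_cases h : i = j <;> simp [h]
      rw [this, Matrix.mul_add, Matrix.add_mul, Matrix.mul_smul, Matrix.smul_mul, Matrix.mul_smul,
        Matrix.smul_mul, Matrix.mul_one, ← hρA, ← hσA]
    have h2 : ρ - σ = A * diagonal (fun k => ((1 - (s k)⁻¹ : ℝ) : ℂ)) * Aᴴ := by
      have : diagonal (fun k => ((1 - (s k)⁻¹ : ℝ) : ℂ)) =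
          (1 : Matrix ι ι ℂ) - diagonal (fun k => ((s k)⁻¹ : ℂ)) := by
        ext i j
        by_cases h : i = j <;> simp [h]
      rw [this, Matrix.mul_sub, Matrix.sub_mul, Matrix.mul_one, ← hρA, ← hσA]
    rw [h1, h2, rldFisher_conj_diagonal hA hw]
    intro k
    rcases hx.1.eq_or_lt with h | h
    · rw [← h]; simpa using hs k
    · have : 0 ≤ (1 - x) * (s k)⁻¹ := mul_nonneg (by linarith [hx.2]) (hu k).le
      linarith
  have hinner (t : ℝ) (ht : t ∈ Set.Icc (0 : ℝ) 1) :
      ∫ x in (0 : ℝ)..t, rldFisher ((x : ℂ) • ρ + ((1 - x : ℝ) : ℂ) • σ) (ρ - σ) =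
        ∑ k, w k * ((1 - (s k)⁻¹) *
          (Real.log (t + (1 - t) * (s k)⁻¹) - Real.log (s k)⁻¹)) := by
    rw [intervalIntegral.integral_congr (g := fun x =>
      ∑ k, w k * ((1 - (s k)⁻¹) ^ 2 / (x + (1 - x) * (s k)⁻¹)))]
    · rw [intervalIntegral.integral_finsetSum
        fun k _ => (integral_sq_div_affine (hu k) ht).1.const_mul _]
      simp only [intervalIntegral.integral_const_mul]
      exact Finset.sum_congr rfl fun k _ => by rw [(integral_sq_div_affine (hu k) ht).2]
    · intro x hx
      rw [Set.uIcc_of_le ht.1] at hx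
      exact hJ x ⟨hx.1, hx.2.trans ht.2⟩
  rw [rldDiv, intervalIntegral.integral_congr (g := fun t => ∑ k, w k * ((1 - (s k)⁻¹) *
          (Real.log (t + (1 - t) * (s k)⁻¹) - Real.log (s k)⁻¹)))]
  · rw [intervalIntegral.integral_finsetSum
      fun k _ => (integral_log_affine (hu k)).1.const_mul _]
    have h3 : ∑ k, w k * ((s k)⁻¹ - 1 - Real.log (s k)⁻¹) =
        ∑ k, w k * (s k)⁻¹ - ∑ k, w k + ∑ k, w k * Real.log (s k) := by
      rw [← Finset.sum_sub_distrib, ← Finset.sum_add_distrib]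
      exact Finset.sum_congr rfl fun k _ => by rw [Real.log_inv]; ring
    rw [Finset.sum_congr rfl fun k _ => by
      rw [intervalIntegral.integral_const_mul, (integral_log_affine (hu k)).2], h3, hsumq, hsumw]
    ring
  · intro t ht
    rw [Set.uIcc_of_le zero_le_one] at ht
    exact hinner t ht

theorem rldDiv_eq_trace_log {ρ σ : Matrix ι ι ℂ} (hρ : IsFaithfulState ρ)
    (hσ : IsFaithfulState σ) : ((rldDiv ρ σ : ℝ) : ℂ) =
      (ρ * cfc Real.log (cfc Real.sqrt ρ * σ⁻¹ * cfc Real.sqrt ρ)).trace := by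
  obtain ⟨A, s, w, hs, -, hw, hρA, hσA, htr⟩ := exists_simultaneous_congruence hρ.1 hσ.1
  rw [htr, rldDiv_eq_sum_log hρ hσ hs hw hρA hσA]
  push_cast
  rfl

/-- The bound by a reverse test: `ρ` and `σ` are the images of two distributions under one CQ map,
and the classical divergence of these distributions is the RLD divergence. -/
theorem CQMonotone.le_rldDiv {D : Quantity} (hcl : AgreesWithClassical D) (hD : CQMonotone D)
    {ρ σ : Matrix ι ι ℂ} (hρ : IsFaithfulState ρ) (hσ : IsFaithfulState σ) :
    D ι ρ σ ≤ ((rldDiv ρ σ : ℝ) : EReal) := by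
  obtain ⟨A, s, w, hs, hwpos, hw, hρA, hσA, -⟩ := exists_simultaneous_congruence hρ.1 hσ.1
  let Φ : CQMap ι ι :=
    { state := fun k => A * diagonal (Pi.single k ((w k : ℂ)⁻¹)) * Aᴴ
      posSemidef := fun k => by
        refine (Matrix.PosSemidef.diagonal fun i => ?_).mul_mul_conjTranspose_same A
        by_cases h : i = k
        · subst h
          simpa using (hwpos i).le
        · simp [h]
      trace_eq_one := fun k => by
        rw [trace_conj_diagonal, Finset.sum_eq_single k (by intros; simp [*]) (by simp), hw,
          Pi.single_eq_same]
        exact mul_inv_cancel₀ (by exact_mod_cast (hwpos k).ne') }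
  have happ (p : ι → ℝ) :
      Φ.apply p = A * diagonal (fun k => ((p k / w k : ℝ) : ℂ)) * Aᴴ := by
    have : diagonal (fun k => ((p k / w k : ℝ) : ℂ)) =
        ∑ k, (p k : ℂ) • diagonal (Pi.single k ((w k : ℂ)⁻¹)) := by
      ext i j
      rw [Matrix.sum_apply]
      by_cases h : i = j
      · subst h
        simp [Pi.single_apply, div_eq_mul_inv]
      · simp [h]
    rw [this, Finset.mul_sum, Finset.sum_mul]
    simp only [CQMap.apply, Φ, Matrix.mul_smul, Matrix.smul_mul]
  have hΦρ : Φ.apply w = ρ := by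
    rw [happ, hρA]
    simp [div_self (hwpos _).ne']
  have hΦσ : Φ.apply (fun k => w k * (s k)⁻¹) = σ := by
    rw [happ, hσA]
    congr 3
    ext k
    rw [mul_div_cancel_left₀ _ (hwpos k).ne', Complex.ofReal_inv]
  have hp : IsFaithfulDist w := by
    refine ⟨hwpos, ?_⟩
    have h := hρ.2
    rw [hρA, trace_mul_comm] at h
    simp only [Matrix.trace, diag_apply, hw] at h
    exact_mod_cast h
  have hq : IsFaithfulDist (fun k => w k * (s k)⁻¹) := by
    refine ⟨fun k => mul_pos (hwpos k) (inv_pos.2 (hs k)), ?_⟩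
    have h := hσ.2
    rw [hσA, trace_conj_diagonal] at h
    simp only [hw] at h
    exact_mod_cast h
  have h := hD ι ι Φ w (fun k => w k * (s k)⁻¹) hp hq (by rwa [hΦρ]) (by rwa [hΦσ])
  rw [hΦρ, hΦσ, hcl ι _ _ hp hq] at h
  refine h.trans_eq ?_
  rw [rldDiv_eq_sum_log hρ hσ hs hw hρA hσA, classicalDiv]
  congr 2
  ext k
  have := (hwpos k).ne'
  have := (hs k).ne'
  congr 2
  field_simp

end RLD

/-! ### Pinching and the measurement it defines -/

section Pinching

variable {ι C : Type} [Fintype ι] [DecidableEq ι] [Fintype C] [DecidableEq C]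

open scoped MatrixOrder Matrix.Norms.L2Operator in
/-- Operator monotonicity of the logarithm, in terms of positive semidefiniteness. -/
theorem log_le_log_of_posSemidef_sub {A B : Matrix ι ι ℂ} (hA : A.PosDef)
    (hAB : (B - A).PosSemidef) : (cfc Real.log B - cfc Real.log A).PosSemidef := by
  have h := CFC.log_le_log (A := Matrix ι ι ℂ) (Matrix.le_iff.2 hAB) hA.isStrictlyPositive
  exact Matrix.le_iff.1 h

open scoped MatrixOrder in
theorem trace_mul_nonneg_of_posSemidef {A B : Matrix ι ι ℂ} (hA : A.PosSemidef)
    (hB : B.PosSemidef) : 0 ≤ (A * B).trace := by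
  obtain ⟨R, rfl⟩ := CStarAlgebra.nonneg_iff_eq_star_mul_self.mp hA.nonneg
  have h := (hB.mul_mul_conjTranspose_same R).trace_nonneg
  rwa [trace_mul_comm, ← Matrix.mul_assoc] at h

/-- The pinching inequality `N ≤ |C| ∑ c, P c N P c` for a matrix all of whose diagonal blocks
`P c N P c`, with respect to the partition into the fibres of `cl`, are diagonal. -/
theorem posSemidef_card_smul_diagonal_sub {N : Matrix ι ι ℂ} (hN : N.PosSemidef) (cl : ι → C)
    (hd : ∀ i j, cl i = cl j → i ≠ j → N i j = 0) :
    (diagonal (fun i => (Fintype.card C : ℂ) * N i i) - N).PosSemidef := by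
  -- `∑ c d, (P c - P d) N (P c - P d) ≥ 0` expands to `2 (|C| ∑ c, P c N P c - N)`.
  let P (c : C) : Matrix ι ι ℂ := diagonal fun i => if cl i = c then 1 else 0
  have hP (c : C) : (P c)ᴴ = P c := by
    simp only [P, diagonal_conjTranspose]
    congr 1
    ext i
    by_cases h : cl i = c <;> simp [h]
  have h1 : (∑ c, ∑ d, (P c - P d) * N * (P c - P d)).PosSemidef := by
    refine posSemidef_sum _ fun c _ => posSemidef_sum _ fun d _ => ?_
    have := hN.mul_mul_conjTranspose_same (P c - P d)
    rwa [conjTranspose_sub, hP, hP] at this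
  have h2 : ∑ c, ∑ d, (P c - P d) * N * (P c - P d) =
      (2 : ℝ) • (diagonal (fun i => (Fintype.card C : ℂ) * N i i) - N) := by
    have hone : ∑ c, P c = 1 := by
      ext i j
      rw [Matrix.sum_apply]
      by_cases h : i = j
      · subst h; simp [P]
      · simp [P, h]
    have hdiag : ∑ c, P c * N * P c = diagonal fun i => N i i := by
      ext i j
      simp only [P, Matrix.sum_apply, Matrix.mul_diagonal, Matrix.diagonal_mul]
      by_cases h : i = j
      · subst h; simp
      · by_cases hc : cl i = cl j
        · simp [h, hd i j hc h]
        · rw [diagonal_apply_ne _ h]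
          refine Finset.sum_eq_zero fun c _ => ?_
          by_cases h1 : cl i = c
          · have h2 : cl j ≠ c := fun h2 => hc (h1.trans h2.symm)
            simp [h2]
          · simp [h1]
    have hexp (c d : C) : (P c - P d) * N * (P c - P d) =
        P c * N * P c - P c * N * P d - P d * N * P c + P d * N * P d := by noncomm_ring
    have hcd : ∑ c, ∑ d, P c * N * P d = N := by
      simp only [← Finset.mul_sum, ← Finset.sum_mul, hone, Matrix.one_mul, Matrix.mul_one]
    have hdc : ∑ c, ∑ d, P d * N * P c = N := by rw [Finset.sum_comm]; exact hcd
    simp only [hexp, Finset.sum_add_distrib, Finset.sum_sub_distrib, hcd, hdc]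
    simp only [Finset.sum_const, ← Finset.smul_sum, hdiag, Finset.card_univ,
      ← Nat.cast_smul_eq_nsmul ℂ]
    ext i j
    by_cases h : i = j
    · subst h; simp; ring
    · simp [h]; ring
  rw [h2] at h1
  have h3 := h1.smul (α := ℝ) (a := 2⁻¹) (by norm_num)
  rwa [smul_smul, inv_mul_cancel₀ (by norm_num), one_smul] at h3

/-- The eigenbasis `V`, whose vectors are grouped by `cl` into eigenspaces, can be rotated inside
each group so that the diagonal blocks of `ρ` become diagonal. The new basis `Z` is indexed by the
sigma type of the fibres of `cl`. -/
theorem exists_basis_diagonal_blocks {ρ V : Matrix ι ι ℂ} (hρ : ρ.IsHermitian)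
    (hV : Vᴴ * V = 1) (hV' : V * Vᴴ = 1) (cl : ι → C) (f : C → ℝ) :
    ∃ (X : Type) (_ : Fintype X) (_ : DecidableEq X) (Z : Matrix ι X ℂ) (cl' : X → C),
      Zᴴ * Z = 1 ∧ Z * Zᴴ = 1 ∧
      Z * diagonal (fun x => (f (cl' x) : ℂ)) * Zᴴ =
        V * diagonal (fun i => (f (cl i) : ℂ)) * Vᴴ ∧
      ∀ x y, cl' x = cl' y → x ≠ y → (Zᴴ * ρ * Z) x y = 0 := by
  let F (c : C) : Type := {i // cl i = c}
  let e : (Σ c, F c) ≃ ι := Equiv.sigmaFiberEquiv cl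
  have he (x : Σ c, F c) : cl (e x) = x.1 := x.2.2
  let V' : Matrix ι (Σ c, F c) ℂ := V.submatrix id e
  have hV₁ : V'ᴴ * V' = 1 := by
    simp only [V', conjTranspose_submatrix]
    rw [← submatrix_mul _ _ _ id _ Function.bijective_id, hV, submatrix_one_equiv]
  have hV₂ : V' * V'ᴴ = 1 := by
    simp only [V', conjTranspose_submatrix]
    rw [submatrix_mul_equiv, hV', submatrix_id_id]
  let N := V'ᴴ * ρ * V'
  have hN : N.IsHermitian := isHermitian_conjTranspose_mul_mul _ hρ
  choose W a hW hW' hNW using fun c : C =>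
    exists_unitary_diagonalization (hN.submatrix (Sigma.mk c : F c → Σ c, F c))
  let B := blockDiagonal' W
  have hB : Bᴴ = blockDiagonal' fun c => (W c)ᴴ := blockDiagonal'_conjTranspose W
  have hB₁ : Bᴴ * B = 1 := by
    rw [hB, ← blockDiagonal'_mul]
    simp only [hW]
    exact blockDiagonal'_one
  have hB₂ : B * Bᴴ = 1 := by
    rw [hB, ← blockDiagonal'_mul]
    simp only [hW']
    exact blockDiagonal'_one
  refine ⟨Σ c, F c, inferInstance, inferInstance, V' * B, Sigma.fst, ?_, ?_, ?_, ?_⟩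
  · calc (V' * B)ᴴ * (V' * B) = Bᴴ * (V'ᴴ * V') * B := by
          rw [conjTranspose_mul]; simp only [Matrix.mul_assoc]
      _ = 1 := by rw [hV₁, Matrix.mul_one, hB₁]
  · calc V' * B * (V' * B)ᴴ = V' * (B * Bᴴ) * V'ᴴ := by
          rw [conjTranspose_mul]; simp only [Matrix.mul_assoc]
      _ = 1 := by rw [hB₂, Matrix.mul_one, hV₂]
  · have hcomm : B * diagonal (fun x : Σ c, F c => (f x.1 : ℂ)) * Bᴴ =
        diagonal (fun x : Σ c, F c => (f x.1 : ℂ)) := by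
      rw [hB, ← blockDiagonal'_diagonal (fun c (_ : F c) => (f c : ℂ)), ← blockDiagonal'_mul,
        ← blockDiagonal'_mul]
      congr 1
      ext1 c
      have : diagonal (fun _ : F c => (f c : ℂ)) = (f c : ℂ) • 1 := by
        rw [smul_one_eq_diagonal]
      rw [this, Matrix.mul_smul, Matrix.smul_mul, Matrix.mul_one, hW']
    calc V' * B * diagonal (fun x : Σ c, F c => (f x.1 : ℂ)) * (V' * B)ᴴ
        = V' * (B * diagonal (fun x : Σ c, F c => (f x.1 : ℂ)) * Bᴴ) * V'ᴴ := by
          rw [conjTranspose_mul]; simp only [Matrix.mul_assoc]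
      _ = V' * (diagonal (fun i => (f (cl i) : ℂ))).submatrix e e * V'ᴴ := by
          rw [hcomm, submatrix_diagonal_equiv]
          congr 3
          ext x
          simp [he]
      _ = _ := by
          simp only [V', conjTranspose_submatrix]
          rw [submatrix_mul_equiv, submatrix_mul_equiv, submatrix_id_id]
  · rintro ⟨c, i⟩ ⟨c', j⟩ (rfl : c = c') hij
    have hZ : (V' * B)ᴴ * ρ * (V' * B) = Bᴴ * (N * B) := by
      rw [conjTranspose_mul]; simp only [N, Matrix.mul_assoc]
    have hr (M : Matrix (Σ c, F c) (Σ c, F c) ℂ) (x : Σ c, F c) (j : F c) :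
        (M * B) x ⟨c, j⟩ = ∑ k, M x ⟨c, k⟩ * W c k j := by
      rw [Matrix.mul_apply, Fintype.sum_sigma, Finset.sum_eq_single c]
      · simp [B, blockDiagonal'_apply_eq]
      · intro d _ hd
        exact Finset.sum_eq_zero fun k _ => by simp [B, blockDiagonal'_apply_ne _ _ _ hd]
      · simp
    have hl (M : Matrix (Σ c, F c) (Σ c, F c) ℂ) (x : Σ c, F c) (i : F c) :
        (Bᴴ * M) ⟨c, i⟩ x = ∑ k, (W c)ᴴ i k * M ⟨c, k⟩ x := by
      rw [hB, Matrix.mul_apply, Fintype.sum_sigma, Finset.sum_eq_single c]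
      · simp [blockDiagonal'_apply_eq]
      · intro d _ hd
        exact Finset.sum_eq_zero fun k _ => by simp [blockDiagonal'_apply_ne _ _ _ hd.symm]
      · simp
    have h1 : (Bᴴ * (N * B)) ⟨c, i⟩ ⟨c, j⟩ =
        ((W c)ᴴ * (N.submatrix (Sigma.mk c) (Sigma.mk c) * W c)) i j := by
      simp only [hl, hr, Matrix.mul_apply, submatrix_apply]
    rw [hZ, h1, hNW c]
    have h2 : (W c)ᴴ * (W c * diagonal (fun k => (a c k : ℂ)) * (W c)ᴴ * W c) =
        diagonal (fun k => (a c k : ℂ)) := by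
      rw [Matrix.mul_assoc _ (W c)ᴴ, hW, Matrix.mul_one, ← Matrix.mul_assoc, hW, Matrix.one_mul]
    rw [h2, diagonal_apply_ne]
    rintro rfl
    exact hij rfl

/-- The measurement in an orthonormal basis, the columns of `Z`. -/
noncomputable def basisMeasurement {X : Type} [Fintype X] [DecidableEq X] (Z : Matrix ι X ℂ)
    (hZ : Z * Zᴴ = 1) : QCMap ι X where
  effect x := Z * diagonal (Pi.single x 1 : X → ℂ) * Zᴴ
  posSemidef x := by
    refine (Matrix.PosSemidef.diagonal fun i => ?_).mul_mul_conjTranspose_same Z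
    by_cases h : i = x
    · subst h; simp
    · simp [h]
  sum_eq_one := by
    rw [← Matrix.sum_mul, ← Matrix.mul_sum]
    have : ∑ x, diagonal (Pi.single x (1 : ℂ)) = (1 : Matrix X X ℂ) := by
      ext i j
      rw [Matrix.sum_apply]
      by_cases h : i = j
      · subst h; simp [Pi.single_apply]
      · simp [h]
    rw [this, Matrix.mul_one, hZ]

theorem basisMeasurement_apply {X : Type} [Fintype X] [DecidableEq X] (Z : Matrix ι X ℂ)
    (hZ : Z * Zᴴ = 1) (ρ : Matrix ι ι ℂ) (x : X) :
    (basisMeasurement Z hZ).apply ρ x = ((Zᴴ * ρ * Z) x x).re := by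
  simp [QCMap.apply, basisMeasurement, trace_mul_conj_diagonal, Pi.single_apply]

/-- A measurement that loses at most `log |C|` of the relative entropy, if the eigenvalues of `σ`
depend only on a label in `C`. -/
theorem exists_measurement_umegaki_le {ρ σ V : Matrix ι ι ℂ} (hρ : IsFaithfulState ρ)
    (hσ : IsFaithfulState σ) (hV : Vᴴ * V = 1) (hV' : V * Vᴴ = 1) (cl : ι → C) (f : C → ℝ)
    (hσV : σ = V * diagonal (fun i => (f (cl i) : ℂ)) * Vᴴ) :
    ∃ (X : Type) (_ : Fintype X) (_ : DecidableEq X) (M : QCMap ι X),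
      IsFaithfulDist (M.apply ρ) ∧ IsFaithfulDist (M.apply σ) ∧
      umegaki ρ σ ≤ classicalDiv (M.apply ρ) (M.apply σ) + Real.log (Fintype.card C) := by
  obtain ⟨X, _, _, Z, cl', hZ, hZ', hZσ, hd⟩ :=
    exists_basis_diagonal_blocks hρ.1.isHermitian hV hV' cl f
  rw [← hσV] at hZσ
  have hinj : Function.Injective Z.mulVec := by
    intro v w h
    have := congrArg (Zᴴ *ᵥ ·) h
    simpa [Matrix.mulVec_mulVec, hZ] using this
  have hdist (τ : Matrix ι ι ℂ) (hτ : IsFaithfulState τ) :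
      (∀ x, (Zᴴ * τ * Z) x x = ((basisMeasurement Z hZ').apply τ x : ℂ)) ∧
      IsFaithfulDist ((basisMeasurement Z hZ').apply τ) := by
    have hpd : (Zᴴ * τ * Z).PosDef := hτ.1.conjTranspose_mul_mul_same hinj
    have h1 (x : X) : (Zᴴ * τ * Z) x x = ((basisMeasurement Z hZ').apply τ x : ℂ) := by
      rw [basisMeasurement_apply]
      exact Complex.eq_re_of_ofReal_le (r := 0) (by simpa using (hpd.diag_pos (i := x)).le)
    refine ⟨h1, fun x => ?_, ?_⟩
    · have := hpd.diag_pos (i := x)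
      rw [h1] at this
      exact_mod_cast this
    · have h2 : (Zᴴ * τ * Z).trace = 1 := by
        rw [trace_mul_comm, ← Matrix.mul_assoc, hZ', Matrix.one_mul, hτ.2]
      simp only [Matrix.trace, diag_apply, h1] at h2
      exact_mod_cast h2
  obtain ⟨hp, hpd⟩ := hdist ρ hρ
  obtain ⟨hq, hqd⟩ := hdist σ hσ
  set p := (basisMeasurement Z hZ').apply ρ with hpdef
  set q := (basisMeasurement Z hZ').apply σ with hqdef
  refine ⟨X, inferInstance, inferInstance, basisMeasurement Z hZ', hpd, hqd, ?_⟩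
  have hqf (x : X) : q x = f (cl' x) := by
    have h : Zᴴ * σ * Z = diagonal (fun x => (f (cl' x) : ℂ)) := by
      rw [← hZσ]
      calc _ = (Zᴴ * Z) * diagonal (fun x => (f (cl' x) : ℂ)) * (Zᴴ * Z) := by
            simp only [Matrix.mul_assoc]
        _ = _ := by rw [hZ, Matrix.one_mul, Matrix.mul_one]
    have h1 := hq x
    rw [h, diagonal_apply_eq] at h1
    exact_mod_cast h1.symm
  obtain ⟨x₀⟩ : Nonempty X := by
    by_contra h
    rw [not_nonempty_iff] at h
    simpa using hpd.2
  have hk : (0 : ℝ) < Fintype.card C := by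
    exact_mod_cast Fintype.card_pos_iff.2 ⟨cl' x₀⟩
  set k : ℝ := (Fintype.card C : ℝ) with hkdef
  -- `ρ` is dominated by `|C|` times its pinching, which is diagonal in the measured basis.
  have hpinch : (Z * diagonal (fun x => ((k * p x : ℝ) : ℂ)) * Zᴴ - ρ).PosSemidef := by
    have h1 := (posSemidef_card_smul_diagonal_sub
      (hρ.1.posSemidef.conjTranspose_mul_mul_same Z) cl' hd).mul_mul_conjTranspose_same Z
    have h2 : Z * (Zᴴ * ρ * Z) * Zᴴ = ρ := by
      calc _ = (Z * Zᴴ) * ρ * (Z * Zᴴ) := by simp only [Matrix.mul_assoc]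
        _ = ρ := by rw [hZ', Matrix.one_mul, Matrix.mul_one]
    rw [Matrix.mul_sub, Matrix.sub_mul, h2] at h1
    simpa only [hp, hkdef, Complex.ofReal_mul, Complex.ofReal_natCast] using h1
  have hlog := log_le_log_of_posSemidef_sub hρ.1 hpinch
  rw [cfc_conj_diagonal hZ hZ'] at hlog
  have hle : (ρ * cfc Real.log ρ).trace.re ≤ ∑ x, p x * Real.log (k * p x) := by
    have h1 := trace_mul_nonneg_of_posSemidef hρ.1.posSemidef hlog
    rw [Matrix.mul_sub, trace_sub, trace_mul_conj_diagonal] at h1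
    simp only [hp] at h1
    have h2 := (Complex.nonneg_iff.1 h1).1
    simp only [← Complex.ofReal_mul, ← Complex.ofReal_sum, Complex.sub_re, Complex.ofReal_re] at h2
    linarith
  have hσlog : (ρ * cfc Real.log σ).trace.re = ∑ x, p x * Real.log (q x) := by
    rw [← hZσ, cfc_conj_diagonal hZ hZ', trace_mul_conj_diagonal]
    simp only [hp, ← Complex.ofReal_mul, ← Complex.ofReal_sum, Complex.ofReal_re, hqf]
  rw [umegaki, Matrix.mul_sub, trace_sub, Complex.sub_re, hσlog]
  refine (sub_le_sub_right hle _).trans_eq ?_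
  have h3 : Real.log k = ∑ x, p x * Real.log k := by rw [← Finset.sum_mul, hpd.2, one_mul]
  rw [h3, classicalDiv, ← Finset.sum_sub_distrib, ← Finset.sum_add_distrib]
  refine Finset.sum_congr rfl fun x _ => ?_
  rw [Real.log_mul hk.ne' (hpd.1 x).ne', Real.log_div (hpd.1 x).ne' (hqd.1 x).ne']
  ring

end Pinching

/-! ### Tensor powers -/

section Tensor

variable {ι κ : Type} [Fintype ι] [DecidableEq ι] [Fintype κ] [DecidableEq κ]

omit [DecidableEq ι] [DecidableEq κ] in
theorem IsFaithfulState.kronecker {ρ : Matrix ι ι ℂ} {τ : Matrix κ κ ℂ}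
    (hρ : IsFaithfulState ρ) (hτ : IsFaithfulState τ) : IsFaithfulState (ρ ⊗ₖ τ) :=
  ⟨hρ.1.kronecker hτ.1, by rw [trace_kronecker, hρ.2, hτ.2, one_mul]⟩

theorem conj_diagonal_kronecker (U : Matrix ι ι ℂ) (V : Matrix κ κ ℂ) (a : ι → ℂ) (b : κ → ℂ) :
    (U * diagonal a * Uᴴ) ⊗ₖ (V * diagonal b * Vᴴ) =
      (U ⊗ₖ V) * diagonal (fun x => a x.1 * b x.2) * (U ⊗ₖ V)ᴴ := by
  rw [mul_kronecker_mul, mul_kronecker_mul, diagonal_kronecker_diagonal, conjTranspose_kronecker]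

theorem kronecker_unitary {U : Matrix ι ι ℂ} {V : Matrix κ κ ℂ} (hU : Uᴴ * U = 1)
    (hV : Vᴴ * V = 1) : (U ⊗ₖ V)ᴴ * (U ⊗ₖ V) = 1 := by
  rw [conjTranspose_kronecker, ← mul_kronecker_mul, hU, hV, one_kronecker_one]

theorem kronecker_unitary' {U : Matrix ι ι ℂ} {V : Matrix κ κ ℂ} (hU : U * Uᴴ = 1)
    (hV : V * Vᴴ = 1) : (U ⊗ₖ V) * (U ⊗ₖ V)ᴴ = 1 := by
  rw [conjTranspose_kronecker, ← mul_kronecker_mul, hU, hV, one_kronecker_one]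

theorem log_kronecker {ρ : Matrix ι ι ℂ} {τ : Matrix κ κ ℂ} (hρ : ρ.PosDef) (hτ : τ.PosDef) :
    cfc Real.log (ρ ⊗ₖ τ) = cfc Real.log ρ ⊗ₖ 1 + 1 ⊗ₖ cfc Real.log τ := by
  obtain ⟨U, a, hU, hU', ha, rfl⟩ := exists_unitary_diagonalization_pos hρ
  obtain ⟨V, b, hV, hV', hb, rfl⟩ := exists_unitary_diagonalization_pos hτ
  rw [conj_diagonal_kronecker]
  simp only [← Complex.ofReal_mul]
  rw [cfc_conj_diagonal (kronecker_unitary hU hV) (kronecker_unitary' hU' hV')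
      (fun x : ι × κ => a x.1 * b x.2), cfc_conj_diagonal hU hU', cfc_conj_diagonal hV hV']
  have h1 : (1 : Matrix ι ι ℂ) = U * diagonal (fun _ => 1) * Uᴴ := by
    rw [diagonal_one, Matrix.mul_one, hU']
  have h2 : (1 : Matrix κ κ ℂ) = V * diagonal (fun _ => 1) * Vᴴ := by
    rw [diagonal_one, Matrix.mul_one, hV']
  rw [h1, h2, conj_diagonal_kronecker, conj_diagonal_kronecker, ← Matrix.add_mul,
    ← Matrix.mul_add, diagonal_add]
  congr 3
  ext x
  rw [Real.log_mul (ha _).ne' (hb _).ne']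
  simp

theorem umegaki_kronecker {ρ₁ σ₁ : Matrix ι ι ℂ} {ρ₂ σ₂ : Matrix κ κ ℂ}
    (hρ₁ : IsFaithfulState ρ₁) (hσ₁ : IsFaithfulState σ₁) (hρ₂ : IsFaithfulState ρ₂)
    (hσ₂ : IsFaithfulState σ₂) :
    umegaki (ρ₁ ⊗ₖ ρ₂) (σ₁ ⊗ₖ σ₂) = umegaki ρ₁ σ₁ + umegaki ρ₂ σ₂ := by
  have h : cfc Real.log (ρ₁ ⊗ₖ ρ₂) - cfc Real.log (σ₁ ⊗ₖ σ₂) =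
      (cfc Real.log ρ₁ - cfc Real.log σ₁) ⊗ₖ 1 + 1 ⊗ₖ (cfc Real.log ρ₂ - cfc Real.log σ₂) := by
    rw [log_kronecker hρ₁.1 hρ₂.1, log_kronecker hσ₁.1 hσ₂.1]
    ext ⟨i, i'⟩ ⟨j, j'⟩
    simp only [Matrix.add_apply, Matrix.sub_apply, kronecker_apply]
    ring
  rw [umegaki, h, Matrix.mul_add, ← mul_kronecker_mul, ← mul_kronecker_mul, Matrix.mul_one,
    Matrix.mul_one, trace_add, trace_kronecker, trace_kronecker, hρ₁.2, hρ₂.2, one_mul, mul_one,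
    Complex.add_re]
  rfl

/-- The tensor powers `ρ^{⊗(n+1)}` and `σ^{⊗(n+1)}`: they are faithful states, both divergences are
multiplied by `n + 1`, and `σ^{⊗(n+1)}` is diagonalized with the eigenvalues `∏ i, s i ^ m i`,
where the type `m` consists of multiplicities that sum to `n + 1`. -/
theorem IsAdditive.exists_tensor_power {D : Quantity} (hD : IsAdditive D)
    {ρ σ : Matrix ι ι ℂ} (hρ : IsFaithfulState ρ) (hσ : IsFaithfulState σ) {V : Matrix ι ι ℂ}
    {s : ι → ℝ} (hV : Vᴴ * V = 1) (hV' : V * Vᴴ = 1)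
    (hσV : σ = V * diagonal (fun i => (s i : ℂ)) * Vᴴ) (n : ℕ) :
    ∃ (κ : Type) (_ : Fintype κ) (_ : DecidableEq κ) (ρn σn W : Matrix κ κ ℂ) (m : κ → ι → ℕ),
      IsFaithfulState ρn ∧ IsFaithfulState σn ∧ umegaki ρn σn = (n + 1) * umegaki ρ σ ∧
      D κ ρn σn = (n + 1) • D ι ρ σ ∧ Wᴴ * W = 1 ∧ W * Wᴴ = 1 ∧
      σn = W * diagonal (fun x => ((∏ i, s i ^ m x i : ℝ) : ℂ)) * Wᴴ ∧
      ∀ x, ∑ i, m x i = n + 1 := by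
  induction n with
  | zero =>
    refine ⟨ι, inferInstance, inferInstance, ρ, σ, V, fun x => Pi.single x 1, hρ, hσ, by simp,
      by simp, hV, hV', ?_, fun x => by simp⟩
    rw [hσV]
    congr 3
    ext x
    rw [Finset.prod_eq_single x (by intro b _ hb; simp [hb]) (by simp)]
    simp
  | succ n ih =>
    obtain ⟨κ, _, _, ρn, σn, W, m, hρn, hσn, hu, hDn, hW, hW', hσW, hm⟩ := ih
    refine ⟨κ × ι, inferInstance, inferInstance, ρn ⊗ₖ ρ, σn ⊗ₖ σ, W ⊗ₖ V,
      fun x => m x.1 + Pi.single x.2 1, hρn.kronecker hρ, hσn.kronecker hσ, ?_, ?_,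
      kronecker_unitary hW hV, kronecker_unitary' hW' hV', ?_, ?_⟩
    · rw [umegaki_kronecker hρn hσn hρ hσ, hu]; push_cast; ring
    · rw [hD κ ι ρn σn ρ σ hρn hσn hρ hσ, hDn, succ_nsmul _ (n + 1)]
    · rw [hσV, hσW, conj_diagonal_kronecker]
      congr 3
      ext x
      simp only [Pi.add_apply, pow_add, Finset.prod_mul_distrib, Complex.ofReal_mul]
      congr 2
      rw [Finset.prod_eq_single x.2 (by intro b _ hb; simp [hb]) (by simp)]
      simp
    · intro x
      simp [Finset.sum_add_distrib, hm]

theorem le_of_forall_nat_mul_le_add_log {a b c : ℝ} (hc : 0 ≤ c)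
    (h : ∀ n : ℕ, (n + 1) * a ≤ (n + 1) * b + c * Real.log (n + 2)) : a ≤ b := by
  have hlim : Filter.Tendsto (fun n : ℕ => b + 2 * c * (Real.log (n + 2) / (n + 2)))
      Filter.atTop (nhds (b + 2 * c * 0)) := by
    refine (Filter.Tendsto.const_mul _ ?_).const_add _
    have h2 : Filter.Tendsto (fun n : ℕ => (n : ℝ) + 2) Filter.atTop Filter.atTop :=
      Filter.tendsto_atTop_add_const_right _ _ tendsto_natCast_atTop_atTop
    exact Real.isLittleO_log_id_atTop.tendsto_div_nhds_zero.comp h2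
  rw [mul_zero, add_zero] at hlim
  refine ge_of_tendsto' hlim fun n => ?_
  have hn : (0 : ℝ) < n + 1 := by positivity
  have h1 : a ≤ b + c * Real.log (n + 2) / (n + 1) := by
    rw [← sub_le_iff_le_add', le_div_iff₀ hn]
    linarith [h n]
  have hlog : 0 ≤ Real.log ((n : ℝ) + 2) := Real.log_nonneg (by linarith)
  have h2 : c * Real.log (n + 2) / (n + 1) ≤ 2 * c * (Real.log (n + 2) / (n + 2)) := by
    rw [← mul_div_assoc, div_le_div_iff₀ hn (by linarith)]
    nlinarith [mul_nonneg hc hlog]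
  linarith

end Tensor

/-! ### The lower bound -/

section LowerBound

variable {ι : Type} [Fintype ι] [DecidableEq ι]

theorem IsAdditive.umegaki_le {D : Quantity} (hcl : AgreesWithClassical D) (hD : IsAdditive D)
    (hQC : QCMonotone D) {ρ σ : Matrix ι ι ℂ} (hρ : IsFaithfulState ρ)
    (hσ : IsFaithfulState σ) : ((umegaki ρ σ : ℝ) : EReal) ≤ D ι ρ σ := by
  obtain ⟨V, s, hV, hV', hσV⟩ := exists_unitary_diagonalization hσ.1.isHermitian
  have key (n : ℕ) : (((n + 1) * umegaki ρ σ : ℝ) : EReal) ≤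
      (n + 1) • D ι ρ σ + ((Fintype.card ι * Real.log (n + 2) : ℝ) : EReal) := by
    obtain ⟨κ, _, _, ρn, σn, W, m, hρn, hσn, hu, hDn, hW, hW', hσW, hm⟩ :=
      hD.exists_tensor_power hρ hσ hV hV' hσV n
    have hlt (x : κ) (i : ι) : m x i < n + 2 := by
      have := Finset.single_le_sum (f := m x) (fun _ _ => Nat.zero_le _) (Finset.mem_univ i)
      rw [hm] at this
      omega
    -- The exponents of a type are at most `n + 1`, so there are at most `(n + 2) ^ |ι|` types.
    obtain ⟨X, _, _, M, hp, hq, hle⟩ := exists_measurement_umegaki_le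
      (C := ι → Fin (n + 2)) hρn hσn hW hW' (fun x i => ⟨m x i, hlt x i⟩)
      (fun t => ∏ i, s i ^ (t i : ℕ)) hσW
    have hmono := hQC κ X M ρn σn hρn hσn hp hq
    rw [hcl X _ _ hp hq, hDn] at hmono
    have hcard : Real.log (Fintype.card (ι → Fin (n + 2))) =
        Fintype.card ι * Real.log (n + 2) := by
      simp [Real.log_pow]
    rw [← hu, ← hcard]
    calc ((umegaki ρn σn : ℝ) : EReal)
        ≤ ((classicalDiv (M.apply ρn) (M.apply σn) +
          Real.log (Fintype.card (ι → Fin (n + 2))) : ℝ) : EReal) := EReal.coe_le_coe_iff.2 hle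
      _ ≤ _ := by
          rw [EReal.coe_add]
          exact add_le_add_left hmono _
  induction hd : D ι ρ σ with
  | bot =>
    -- The value `-∞` is excluded: the real divergence of a measurement is a lower bound.
    have := key 0
    rw [hd] at this
    simp at this
  | top => exact le_top
  | coe d =>
    refine EReal.coe_le_coe_iff.2
      (le_of_forall_nat_mul_le_add_log (c := Fintype.card ι) (by positivity) fun n => ?_)
    have := key n
    rw [hd, ← EReal.coe_nsmul, ← EReal.coe_add, EReal.coe_le_coe_iff, nsmul_eq_mul] at this
    exact_mod_cast this

end LowerBound

end QDiv

theorem theorem4 (DQ : QDiv.Quantity) (hcl : QDiv.AgreesWithClassical DQ) :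
    (QDiv.IsAdditive DQ → QDiv.QCMonotone DQ →
      ∀ (ι : Type) [Fintype ι] [DecidableEq ι] (ρ σ : Matrix ι ι ℂ),
        QDiv.IsFaithfulState ρ → QDiv.IsFaithfulState σ →
          ((QDiv.umegaki ρ σ : ℝ) : EReal) ≤ DQ ι ρ σ) ∧
    (QDiv.CQMonotone DQ →
      ∀ (ι : Type) [Fintype ι] [DecidableEq ι] (ρ σ : Matrix ι ι ℂ),
        QDiv.IsFaithfulState ρ → QDiv.IsFaithfulState σ →
          DQ ι ρ σ ≤ ((QDiv.rldDiv ρ σ : ℝ) : EReal)) ∧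
    (∀ (ι : Type) [Fintype ι] [DecidableEq ι] (ρ σ : Matrix ι ι ℂ),
        QDiv.IsFaithfulState ρ → QDiv.IsFaithfulState σ →
          ((QDiv.rldDiv ρ σ : ℝ) : ℂ) =
            (ρ * cfc Real.log (cfc Real.sqrt ρ * σ⁻¹ * cfc Real.sqrt ρ)).trace) :=
  ⟨fun hadd hQC _ _ _ _ _ hρ hσ => hadd.umegaki_le hcl hQC hρ hσ,
    fun hCQ _ _ _ _ _ hρ hσ => hCQ.le_rldDiv hcl hρ hσ,
    fun _ _ _ _ _ hρ hσ => QDiv.rldDiv_eq_trace_log hρ hσ⟩
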